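/- Let $X$ be a positive random variable with Lebesgue density $g$ on $(0,\infty)$, let $Y$ be a random variable whose conditional distribution given $X$ is Poisson with mean $X$, and let $f(y)=\Pr(Y=y)$, $y=0,1,2,\ldots$, be the marginal probability mass function of $Y$. Then: (i) if $g$ is unimodal on $(0,\infty)$, then $f$ is unimodal on $\{0,1,2,\ldots\}$; (ii) if $g$ is decreasing on $(0,\infty)$, then $f$ is decreasing on $\{0,1,2,\ldots\}$; (iii) if $g$ is log-concave on $(0,\infty)$, then $f$ is log-concave on $\{0,1,2,\ldots\}$; (iv) if $g$ is log-convex on $(0,\infty)$, then $f$ is log-convex on $\{0,1,2,\ldots\}$. Here "increasing" and "decreasing" are meant in the weak sense. A real function on $(0,\infty)$ (respectively on $\{0,1,2,\ldots\}$) is unimodal if there is a real number (respectively a nonnegative integer) $m$ such that it is increasing on the set of points $\le m$ of its domain and decreasing on the set of points $\ge m$ of its domain. A nonnegative function $g$ on $(0,\infty)$ is log-concave if $g(\theta x+(1-\theta)y)\ge g(x)^\theta g(y)^{1-\theta}$ for all $x,y>0$ and $\theta\in(0,1)$; a function $g$ on $(0,\infty)$ is log-convex if it is positive and $\log g$ is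 convex there. A nonnegative sequence $f$ on $\{0,1,2,\ldots\}$ is log-concave if $f(y+1)^2\ge f(y)f(y+2)$ for all $y\ge 0$ and $f$ has no internal zeros, that is, $f(j)>0$ whenever $i\le j\le k$, $f(i)>0$ and $f(k)>0$; a sequence $f$ on $\{0,1,2,\ldots\}$ is log-convex if it is positive and $f(y+1)^2\le f(y)f(y+2)$ for all $y\ge 0$. -/

import Mathlib

open MeasureTheory ProbabilityTheory Set

namespace PoissonMixture

/-- A real function is unimodal on `s` if it (weakly) increases on `s` up to some point `m` and
(weakly) decreases on `s` from `m` on. The point `m` need not lie in `s`; on `s = (0, ∞)` a value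
`m ≤ 0` means that the function decreases throughout. -/
def UnimodalOn {α : Type*} [Preorder α] (s : Set α) (f : α → ℝ) : Prop :=
  ∃ m : α, MonotoneOn f (s ∩ Iic m) ∧ AntitoneOn f (s ∩ Ici m)

/-- Log-concavity of a nonnegative function on a set of reals (zeros are allowed). -/
def LogConcaveOn (s : Set ℝ) (f : ℝ → ℝ) : Prop :=
  (∀ x ∈ s, 0 ≤ f x) ∧
    ∀ x ∈ s, ∀ y ∈ s, ∀ θ ∈ Ioo (0 : ℝ) 1,
      f x ^ θ * f y ^ (1 - θ) ≤ f (θ * x + (1 - θ) * y)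

/-- Log-convexity of a positive function on a set of reals. -/
def LogConvexOn (s : Set ℝ) (f : ℝ → ℝ) : Prop :=
  (∀ x ∈ s, 0 < f x) ∧ ConvexOn ℝ s (fun x => Real.log (f x))

/-- Discrete log-concavity: a nonnegative sequence without internal zeros such that
`f (n + 1) ^ 2 ≥ f n * f (n + 2)`. -/
def LogConcaveSeq (f : ℕ → ℝ) : Prop :=
  (∀ n, 0 ≤ f n) ∧
    (∀ i j k, i ≤ j → j ≤ k → 0 < f i → 0 < f k → 0 < f j) ∧
    ∀ n, f n * f (n + 2) ≤ f (n + 1) ^ 2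

/-- Discrete log-convexity: a positive sequence such that `f (n + 1) ^ 2 ≤ f n * f (n + 2)`. -/
def LogConvexSeq (f : ℕ → ℝ) : Prop :=
  (∀ n, 0 < f n) ∧ ∀ n, f (n + 1) ^ 2 ≤ f n * f (n + 2)

/-- The Markov kernel sending `x > 0` to the Poisson distribution with mean `x`
(for `x ≤ 0` it is the point mass at `0`). -/
noncomputable def poissonLawKernel : Kernel ℝ ℕ where
  toFun x := poissonMeasure x.toNNReal
  measurable' := by
    refine Measure.measurable_of_measurable_coe _ fun s hs => ?_
    simp only [poissonMeasure, Measure.sum_apply _ hs, Measure.smul_apply, smul_eq_mul]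
    fun_prop

instance : IsMarkovKernel poissonLawKernel :=
  ⟨fun x => inferInstanceAs (IsProbabilityMeasure (poissonMeasure x.toNNReal))⟩

end PoissonMixture

/-! ### Poisson weights and the mass function of the mixture. -/

namespace PoissonMixture

/-! Write `w n` for the Poisson weight and `f n = ∫ w n * g` for the mixture. Each claim is a sign
statement about the integral of a kernel against `g` (or against `g t * g (s - t)`). The kernel has
zero integral, because `w (n + 1)' = w n - w (n + 1)` gives it a primitive vanishing at both ends.
Replacing `g` by its value at the kernel's sign change then moves the integral in a known direction,
to zero.

Decreasing: the kernel `w (n + 1) - w n` changes sign at `n + 1`. Unimodal with mode `m > 0`: the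
argument runs separately on `(0, m]` and `(m, ∞)` and gives `Δf (n + 1) ≤ m / (n + 2) * Δf n` with
`Δf n = f (n + 1) - f n`. Once `f` stops increasing it never increases again, and it must stop since
`f → 0`. Log-concave and log-convex: `f n * f (n + 2) - f (n + 1) ^ 2` is a double integral, sliced
along lines `t + z = s`. On each slice the symmetrised kernel depends in sign only on `t * z`, and
log-concavity (log-convexity) makes `g t * g z` increase (decrease) with `t * z`. -/

/-- The Poisson weight `x ^ n * exp (-x) / n!`, as a function of the mean. -/
noncomputable def weight (n : ℕ) (x : ℝ) : ℝ := Real.exp (-x) * x ^ n / n.factorial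

/-- The mass at `n` of the Poisson mixture with mixing density `g`. -/
noncomputable def mass (g : ℝ → ℝ) (n : ℕ) : ℝ := ∫ x in Ioi (0 : ℝ), weight n x * g x

lemma continuous_weight (n : ℕ) : Continuous (weight n) := by
  unfold weight; fun_prop

lemma weight_pos (n : ℕ) {x : ℝ} (hx : 0 < x) : 0 < weight n x := by
  unfold weight; positivity

lemma weight_le_one (n : ℕ) {x : ℝ} (hx : 0 < x) : weight n x ≤ 1 := by
  have h : x ^ n / n.factorial ≤ Real.exp x := Real.pow_div_factorial_le_exp x hx.le n
  calc weight n x = Real.exp (-x) * (x ^ n / n.factorial) := by unfold weight; ring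
    _ ≤ Real.exp (-x) * Real.exp x := by gcongr
    _ = 1 := by rw [← Real.exp_add]; simp

lemma weight_succ (n : ℕ) (x : ℝ) : weight (n + 1) x = x / (n + 1) * weight n x := by
  have : (n.factorial : ℝ) ≠ 0 := by positivity
  unfold weight
  rw [Nat.factorial_succ]
  push_cast
  field_simp
  ring

lemma weight_succ_zero (n : ℕ) : weight (n + 1) 0 = 0 := by simp [weight]

lemma hasDerivAt_weight_succ (n : ℕ) (x : ℝ) :
    HasDerivAt (weight (n + 1)) (weight n x - weight (n + 1) x) x := by
  have h := ((hasDerivAt_neg x).exp.mul (hasDerivAt_pow (n + 1) x)).div_const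
    ((n + 1).factorial : ℝ)
  have : (n.factorial : ℝ) ≠ 0 := by positivity
  convert! h using 1
  unfold weight
  rw [Nat.factorial_succ]
  push_cast
  field_simp
  ring

lemma tendsto_weight_atTop (n : ℕ) : Filter.Tendsto (weight n) Filter.atTop (nhds 0) := by
  have h := (Real.tendsto_pow_mul_exp_neg_atTop_nhds_zero n).div_const (n.factorial : ℝ)
  rw [zero_div] at h
  refine h.congr fun x => ?_
  unfold weight; ring

lemma integrableOn_weight (n : ℕ) : IntegrableOn (weight n) (Ioi 0) := by
  have h := (Real.GammaIntegral_convergent (s := n + 1) (by positivity)).div_const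
    (n.factorial : ℝ)
  refine IntegrableOn.congr_fun h (fun x hx => ?_) measurableSet_Ioi
  simp [weight]

lemma integrableOn_weight_mul {g : ℝ → ℝ} (hg : IntegrableOn g (Ioi 0)) (n : ℕ) :
    IntegrableOn (fun x => weight n x * g x) (Ioi 0) := by
  refine Integrable.bdd_mul (c := 1) hg (continuous_weight n).aestronglyMeasurable ?_
  refine (ae_restrict_iff' measurableSet_Ioi).2 (.of_forall fun x hx => ?_)
  rw [Real.norm_of_nonneg (weight_pos n hx).le]
  exact weight_le_one n hx

lemma mass_nonneg {g : ℝ → ℝ} (hg_nonneg : ∀ x ∈ Ioi (0 : ℝ), 0 ≤ g x) (n : ℕ) :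
    0 ≤ mass g n :=
  setIntegral_nonneg measurableSet_Ioi fun x hx => mul_nonneg (weight_pos n hx).le (hg_nonneg x hx)

/-- All weights are positive on `(0, ∞)`, so a zero mass would force `g = 0` almost everywhere. This
also settles the absence of internal zeros. -/
lemma mass_pos {g : ℝ → ℝ} (hg_nonneg : ∀ x ∈ Ioi (0 : ℝ), 0 ≤ g x)
    (hg : IntegrableOn g (Ioi 0)) (hg_one : ∫ x in Ioi (0 : ℝ), g x = 1) (n : ℕ) :
    0 < mass g n := by
  have hae : ∀ᵐ x ∂volume.restrict (Ioi (0 : ℝ)), x ∈ Ioi (0 : ℝ) := ae_restrict_mem measurableSet_Ioi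
  refine (mass_nonneg hg_nonneg n).lt_of_ne fun h => ?_
  have h0 := (integral_eq_zero_iff_of_nonneg_ae (by
    filter_upwards [hae] with x hx using mul_nonneg (weight_pos n hx).le (hg_nonneg x hx))
    (integrableOn_weight_mul hg n)).1 h.symm
  have : ∫ x in Ioi (0 : ℝ), g x = 0 := by
    refine integral_eq_zero_of_ae ?_
    filter_upwards [hae, h0] with x hx hx0
    exact (mul_eq_zero.1 hx0).resolve_left (weight_pos n hx).ne'
  linarith

/-! ### The law of `Y` as an integral against the mixing density. -/

section Law

variable {Ω : Type*} [MeasurableSpace Ω] {P : Measure Ω} [IsProbabilityMeasure P]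
  {X : Ω → ℝ} {Y : Ω → ℕ} {g : ℝ → ℝ}

lemma lintegral_density_eq_one
    (hX : HasLaw X
      ((volume.restrict (Ioi (0 : ℝ))).withDensity (fun x => ENNReal.ofReal (g x))) P) :
    ∫⁻ x in Ioi (0 : ℝ), ENNReal.ofReal (g x) = 1 := by
  have := hX.isProbabilityMeasure_iff.1 inferInstance
  have h := measure_univ
    (μ := (volume.restrict (Ioi (0 : ℝ))).withDensity (fun x => ENNReal.ofReal (g x)))
  rwa [withDensity_apply _ MeasurableSet.univ, Measure.restrict_univ] at h

lemma integrableOn_density (hg_meas : AEMeasurable g (volume.restrict (Ioi (0 : ℝ))))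
    (hg_nonneg : ∀ x ∈ Ioi (0 : ℝ), 0 ≤ g x)
    (hX : HasLaw X
      ((volume.restrict (Ioi (0 : ℝ))).withDensity (fun x => ENNReal.ofReal (g x))) P) :
    IntegrableOn g (Ioi 0) := by
  refine (lintegral_ofReal_ne_top_iff_integrable hg_meas.aestronglyMeasurable ?_).1 ?_
  · filter_upwards [ae_restrict_mem measurableSet_Ioi] with x hx using hg_nonneg x hx
  · rw [lintegral_density_eq_one hX]
    exact ENNReal.one_ne_top

lemma integral_density_eq_one (hg_meas : AEMeasurable g (volume.restrict (Ioi (0 : ℝ))))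
    (hg_nonneg : ∀ x ∈ Ioi (0 : ℝ), 0 ≤ g x)
    (hX : HasLaw X
      ((volume.restrict (Ioi (0 : ℝ))).withDensity (fun x => ENNReal.ofReal (g x))) P) :
    ∫ x in Ioi (0 : ℝ), g x = 1 := by
  rw [integral_eq_lintegral_of_nonneg_ae _ hg_meas.aestronglyMeasurable,
    lintegral_density_eq_one hX, ENNReal.toReal_one]
  filter_upwards [ae_restrict_mem measurableSet_Ioi] with x hx using hg_nonneg x hx

lemma map_real_singleton_eq_mass (hg_meas : AEMeasurable g (volume.restrict (Ioi (0 : ℝ))))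
    (hg_nonneg : ∀ x ∈ Ioi (0 : ℝ), 0 ≤ g x)
    (hX : HasLaw X
      ((volume.restrict (Ioi (0 : ℝ))).withDensity (fun x => ENNReal.ofReal (g x))) P)
    (hY : HasCondDistrib Y X poissonLawKernel P) (n : ℕ) :
    (P.map Y).real {n} = mass g n := by
  have hmap : P.map Y = (P.map X).bind poissonLawKernel := by
    rw [← Measure.snd_compProd, ← hY.map_eq, Measure.snd_map_prodMk₀ hY.aemeasurable_fst]
  have hval : ∀ x, poissonLawKernel x {n} =
      ENNReal.ofReal (Real.exp (-x.toNNReal) * x.toNNReal ^ n / n.factorial) := fun x =>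
    poissonMeasure_singleton _ n
  have hae : ∀ᵐ x ∂volume.restrict (Ioi (0 : ℝ)), x ∈ Ioi (0 : ℝ) := ae_restrict_mem measurableSet_Ioi
  rw [measureReal_def, hmap, hX.map_eq,
    Measure.bind_apply (measurableSet_singleton n) (Kernel.aemeasurable _),
    lintegral_withDensity_eq_lintegral_mul₀ hg_meas.ennreal_ofReal
      (Kernel.measurable_coe _ (measurableSet_singleton n)).aemeasurable, mass,
    integral_eq_lintegral_of_nonneg_ae]
  · congr 1
    refine lintegral_congr_ae ?_
    filter_upwards [hae] with x hx
    rw [Pi.mul_apply, hval, ← ENNReal.ofReal_mul (hg_nonneg x hx), Real.coe_toNNReal _ (le_of_lt hx),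
      mul_comm, weight]
  · filter_upwards [hae] with x hx using mul_nonneg (weight_pos n hx).le (hg_nonneg x hx)
  · exact (continuous_weight n).aestronglyMeasurable.mul hg_meas.aestronglyMeasurable

end Law

end PoissonMixture

/-! ### Monotone and unimodal mixing densities. -/

namespace PoissonMixture

lemma tendsto_mass {g : ℝ → ℝ} (hg : IntegrableOn g (Ioi 0)) :
    Filter.Tendsto (mass g) Filter.atTop (nhds 0) := by
  have h := tendsto_integral_of_dominated_convergence
    (μ := volume.restrict (Ioi (0 : ℝ))) (F := fun n x => weight n x * g x) (f := fun _ => 0)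
    (fun x => |g x|) (fun n => (integrableOn_weight_mul hg n).aestronglyMeasurable) hg.abs ?_ ?_
  · rw [integral_zero] at h
    exact h
  · intro n
    filter_upwards [ae_restrict_mem measurableSet_Ioi] with x hx
    rw [norm_mul, Real.norm_of_nonneg (weight_pos n hx).le]
    exact mul_le_of_le_one_left (norm_nonneg _) (weight_le_one n hx)
  · filter_upwards with x
    have h := ((FloorSemiring.tendsto_pow_div_factorial_atTop x).const_mul
      (Real.exp (-x))).mul_const (g x)
    rw [mul_zero, zero_mul] at h
    refine h.congr fun n => ?_
    unfold weight; ring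

lemma integral_weight_sub (n : ℕ) : ∫ x in Ioi (0 : ℝ), (weight (n + 1) x - weight n x) = 0 := by
  have h := integral_Ioi_of_hasDerivAt_of_tendsto' (a := 0)
    (fun x _ => (hasDerivAt_weight_succ n x).neg)
    (((integrableOn_weight n).sub (integrableOn_weight (n + 1))).neg)
    (tendsto_weight_atTop (n + 1)).neg
  simpa [weight_succ_zero] using h

/-- An antitone mixing density gives an antitone Poisson mixture. -/
theorem antitone_mass {g : ℝ → ℝ} (hg : IntegrableOn g (Ioi 0)) (hanti : AntitoneOn g (Ioi 0)) :
    Antitone (mass g) := by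
  refine antitone_nat_of_succ_le fun n => sub_nonpos.1 ?_
  have hn : (0 : ℝ) < n + 1 := by positivity
  unfold mass
  rw [← integral_sub (integrableOn_weight_mul hg _) (integrableOn_weight_mul hg _)]
  calc ∫ x in Ioi (0 : ℝ), (weight (n + 1) x * g x - weight n x * g x)
      ≤ ∫ x in Ioi (0 : ℝ), (weight (n + 1) x - weight n x) * g (n + 1) := by
        refine setIntegral_mono_on
          ((integrableOn_weight_mul hg _).sub (integrableOn_weight_mul hg _))
          (((integrableOn_weight _).sub (integrableOn_weight _)).mul_const _)
          measurableSet_Ioi fun x hx => ?_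
        have hw := weight_pos n hx
        -- `w (n + 1) x - w n x` has the sign of `x - (n + 1)`, opposite to that of `g x - g (n +
        -- 1)`.
        have key : (x - (n + 1)) * (g x - g (n + 1)) ≤ 0 := by
          rcases le_total x (n + 1) with h | h
          · exact mul_nonpos_of_nonpos_of_nonneg (sub_nonpos.2 h)
              (sub_nonneg.2 (hanti hx (mem_Ioi.2 hn) h))
          · exact mul_nonpos_of_nonneg_of_nonpos (sub_nonneg.2 h)
              (sub_nonpos.2 (hanti (mem_Ioi.2 hn) hx h))
        have : (weight n x / (n + 1)) * ((x - (n + 1)) * (g x - g (n + 1))) ≤ 0 :=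
          mul_nonpos_of_nonneg_of_nonpos (by positivity) key
        have e : (weight n x / (n + 1)) * ((x - (n + 1)) * (g x - g (n + 1))) =
            (weight (n + 1) x * g x - weight n x * g x) -
              (weight (n + 1) x - weight n x) * g (n + 1) := by
          rw [weight_succ]; field_simp
        linarith
    _ = 0 := by rw [integral_mul_const, integral_weight_sub, zero_mul]

/-- The kernel representing `(f (n + 2) - f (n + 1)) - m / (n + 2) * (f (n + 1) - f n)`
for the Poisson mixture `f`. -/
noncomputable def modeKernel (m : ℝ) (n : ℕ) (x : ℝ) : ℝ :=
  (weight (n + 2) x - weight (n + 1) x) - m / (n + 2) * (weight (n + 1) x - weight n x)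

lemma modeKernel_eq (m : ℝ) (n : ℕ) (x : ℝ) :
    modeKernel m n x =
      weight n x / ((n + 1) * (n + 2)) * (x ^ 2 - (n + 2 + m) * x + (n + 1) * m) := by
  have h1 : (n : ℝ) + 1 ≠ 0 := by positivity
  have h2 : (n : ℝ) + 2 ≠ 0 := by positivity
  have h3 : (n : ℝ) + 1 + 1 ≠ 0 := by positivity
  rw [modeKernel, weight_succ (n + 1), weight_succ n]
  push_cast
  field_simp
  ring

/-- The factor `m / (n + 2)` is chosen so that this primitive vanishes at `m`, besides `0` and `∞`;
the kernel thus has zero integral on each side of the mode. -/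
lemma hasDerivAt_modeKernel_primitive (m : ℝ) (n : ℕ) (x : ℝ) :
    HasDerivAt (fun x => m / (n + 2) * weight (n + 1) x - weight (n + 2) x)
      (modeKernel m n x) x := by
  convert! ((hasDerivAt_weight_succ n x).const_mul (m / ((n : ℝ) + 2))).sub
    (hasDerivAt_weight_succ (n + 1) x) using 1
  unfold modeKernel
  ring

lemma modeKernel_primitive_self (m : ℝ) (n : ℕ) :
    m / (n + 2) * weight (n + 1) m - weight (n + 2) m = 0 := by
  rw [weight_succ (n + 1)]
  push_cast
  ring

lemma integrableOn_modeKernel (m : ℝ) (n : ℕ) : IntegrableOn (modeKernel m n) (Ioi 0) :=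
  ((integrableOn_weight _).sub (integrableOn_weight _)).sub
    (((integrableOn_weight _).sub (integrableOn_weight _)).const_mul _)

lemma continuous_modeKernel (m : ℝ) (n : ℕ) : Continuous (modeKernel m n) :=
  ((continuous_weight _).sub (continuous_weight _)).sub
    (continuous_const.mul ((continuous_weight _).sub (continuous_weight _)))

lemma integral_modeKernel_Ioc {m : ℝ} (hm : 0 ≤ m) (n : ℕ) :
    ∫ x in Ioc 0 m, modeKernel m n x = 0 := by
  rw [← intervalIntegral.integral_of_le hm, intervalIntegral.integral_eq_sub_of_hasDerivAt
    (fun x _ => hasDerivAt_modeKernel_primitive m n x)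
    ((continuous_modeKernel m n).intervalIntegrable _ _), modeKernel_primitive_self,
    weight_succ_zero, weight_succ_zero]
  simp

lemma integral_modeKernel_Ioi {m : ℝ} (hm : 0 ≤ m) (n : ℕ) :
    ∫ x in Ioi m, modeKernel m n x = 0 := by
  rw [integral_Ioi_of_hasDerivAt_of_tendsto'
    (fun x _ => hasDerivAt_modeKernel_primitive m n x)
    ((integrableOn_modeKernel m n).mono_set (Ioi_subset_Ioi hm))
    (((tendsto_weight_atTop (n + 1)).const_mul _).sub (tendsto_weight_atTop (n + 2))),
    modeKernel_primitive_self]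
  simp

/-- The quadratic is `(n + 1) * m > 0` at `0` and `-m < 0` at `m`, so its roots straddle `m`: the
kernel changes sign exactly once on each side of the mode. -/
lemma exists_roots {m : ℝ} (hm : 0 < m) (n : ℕ) :
    ∃ a b : ℝ, 0 < a ∧ a < m ∧ m < b ∧
      ∀ x : ℝ, x ^ 2 - (n + 2 + m) * x + (n + 1) * m = (x - a) * (x - b) := by
  have hn : (0 : ℝ) ≤ n := n.cast_nonneg
  have hD : 0 < ((n : ℝ) + 2 + m) ^ 2 - 4 * ((n + 1) * m) := by nlinarith [sq_nonneg ((n : ℝ) + 1 - m)]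
  set r := √(((n : ℝ) + 2 + m) ^ 2 - 4 * ((n + 1) * m)) with hr
  have hr0 : 0 < r := Real.sqrt_pos.2 hD
  have hr2 : r ^ 2 = ((n : ℝ) + 2 + m) ^ 2 - 4 * ((n + 1) * m) := Real.sq_sqrt hD.le
  have hlt : |(n : ℝ) + 2 - m| < r := by
    refine abs_lt_of_sq_lt_sq ?_ hr0.le
    nlinarith
  obtain ⟨h1, h2⟩ := abs_lt.1 hlt
  have h3 : r < n + 2 + m := by
    refine lt_of_pow_lt_pow_left₀ 2 (by positivity) ?_
    nlinarith
  exact ⟨(n + 2 + m - r) / 2, (n + 2 + m + r) / 2, by linarith, by linarith, by linarith,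
    fun x => by nlinarith⟩

lemma mass_second_difference_le {g : ℝ → ℝ} (hg : IntegrableOn g (Ioi 0)) {m : ℝ} (hm : 0 < m)
    (hmono : MonotoneOn g (Ioi 0 ∩ Iic m)) (hanti : AntitoneOn g (Ioi 0 ∩ Ici m)) (n : ℕ) :
    mass g (n + 2) - mass g (n + 1) ≤ m / (n + 2) * (mass g (n + 1) - mass g n) := by
  obtain ⟨a, b, ha, ham, hmb, hroots⟩ := exists_roots hm n
  have hI := integrableOn_weight_mul hg
  have hKg : IntegrableOn (fun x => modeKernel m n x * g x) (Ioi 0) := by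
    have h := ((hI (n + 2)).sub (hI (n + 1))).sub (((hI (n + 1)).sub (hI n)).const_mul (m / (n + 2)))
    refine IntegrableOn.congr_fun h (fun x _ => ?_) measurableSet_Ioi
    simp only [modeKernel, Pi.sub_apply]
    ring
  have hK := integrableOn_modeKernel m n
  have hsub : Ioi m ⊆ Ioi 0 := Ioi_subset_Ioi hm.le
  have hsub' : Ioc 0 m ⊆ Ioi 0 := Ioc_subset_Ioi_self
  have hsign : ∀ x c : ℝ, 0 < x → (x - a) * (x - b) * (g x - c) ≤ 0 →
      modeKernel m n x * g x ≤ modeKernel m n x * c := by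
    intro x c hx h
    have hw := weight_pos n hx
    have h' : weight n x / ((n + 1) * (n + 2)) * ((x - a) * (x - b) * (g x - c)) ≤ 0 :=
      mul_nonpos_of_nonneg_of_nonpos (by positivity) h
    rw [modeKernel_eq, hroots]
    linarith
  have hleft : ∫ x in Ioc 0 m, modeKernel m n x * g x ≤ 0 := by
    calc ∫ x in Ioc 0 m, modeKernel m n x * g x ≤ ∫ x in Ioc 0 m, modeKernel m n x * g a := by
          refine setIntegral_mono_on (hKg.mono_set hsub') ((hK.mono_set hsub').mul_const _)
            measurableSet_Ioc fun x hx => hsign x _ hx.1 ?_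
          have hxb : x - b ≤ 0 := by linarith [hx.2]
          rcases le_total x a with h | h
          · exact mul_nonpos_of_nonneg_of_nonpos
              (mul_nonneg_of_nonpos_of_nonpos (sub_nonpos.2 h) hxb)
              (sub_nonpos.2 (hmono ⟨hx.1, hx.2⟩ ⟨ha, ham.le⟩ h))
          · exact mul_nonpos_of_nonpos_of_nonneg
              (mul_nonpos_of_nonneg_of_nonpos (sub_nonneg.2 h) hxb)
              (sub_nonneg.2 (hmono ⟨ha, ham.le⟩ ⟨hx.1, hx.2⟩ h))
      _ = 0 := by rw [integral_mul_const, integral_modeKernel_Ioc hm.le, zero_mul]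
  have hright : ∫ x in Ioi m, modeKernel m n x * g x ≤ 0 := by
    calc ∫ x in Ioi m, modeKernel m n x * g x ≤ ∫ x in Ioi m, modeKernel m n x * g b := by
          refine setIntegral_mono_on (hKg.mono_set hsub) ((hK.mono_set hsub).mul_const _)
            measurableSet_Ioi fun x hx => hsign x _ (hsub hx) ?_
          have hmx : m < x := hx
          have hxa : 0 ≤ x - a := by linarith
          have hb : b ∈ Ioi 0 ∩ Ici m := ⟨hm.trans hmb, hmb.le⟩
          rcases le_total x b with h | h
          · exact mul_nonpos_of_nonpos_of_nonneg
              (mul_nonpos_of_nonneg_of_nonpos hxa (sub_nonpos.2 h))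
              (sub_nonneg.2 (hanti ⟨hsub hx, hmx.le⟩ hb h))
          · exact mul_nonpos_of_nonneg_of_nonpos
              (mul_nonneg hxa (sub_nonneg.2 h))
              (sub_nonpos.2 (hanti hb ⟨hsub hx, hmx.le⟩ h))
      _ = 0 := by rw [integral_mul_const, integral_modeKernel_Ioi hm.le, zero_mul]
  have htot : ∫ x in Ioi 0, modeKernel m n x * g x ≤ 0 := by
    rw [← Ioc_union_Ioi_eq_Ioi hm.le, setIntegral_union (Ioc_disjoint_Ioi le_rfl) measurableSet_Ioi
      (hKg.mono_set hsub') (hKg.mono_set hsub)]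
    exact add_nonpos hleft hright
  have heq : ∫ x in Ioi 0, modeKernel m n x * g x =
      (mass g (n + 2) - mass g (n + 1)) - m / (n + 2) * (mass g (n + 1) - mass g n) := by
    unfold mass
    have hd : ∀ k, IntegrableOn (fun x => weight (k + 1) x * g x - weight k x * g x) (Ioi 0) :=
      fun k => (hI (k + 1)).sub (hI k)
    rw [← integral_sub (hI _) (hI _), ← integral_sub (hI _) (hI _), ← integral_const_mul,
      ← integral_sub (hd (n + 1)) ((hd n).const_mul _)]
    refine integral_congr_ae (.of_forall fun x => ?_)
    simp only [modeKernel]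
    ring
  linarith

/-- A unimodal mixing density gives a unimodal Poisson mixture. -/
theorem unimodalOn_mass {g : ℝ → ℝ} (hg_nonneg : ∀ x ∈ Ioi (0 : ℝ), 0 ≤ g x)
    (hg : IntegrableOn g (Ioi 0)) (huni : UnimodalOn (Ioi (0 : ℝ)) g) :
    UnimodalOn univ (mass g) := by
  obtain ⟨m, hmono, hanti⟩ := huni
  rcases le_or_gt m 0 with hm | hm
  · have h : AntitoneOn g (Ioi 0) :=
      hanti.mono fun x hx => ⟨hx, hm.trans (le_of_lt hx)⟩
    refine ⟨0, fun i hi j hj _ => ?_, (antitone_mass hg h).antitoneOn _⟩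
    rw [Nat.le_zero.1 hi.2, Nat.le_zero.1 hj.2]
  have hstep : ∀ n, mass g (n + 1) ≤ mass g n → mass g (n + 2) ≤ mass g (n + 1) := by
    intro n h
    have := mass_second_difference_le hg hm hmono hanti n
    have : m / (n + 2) * (mass g (n + 1) - mass g n) ≤ 0 :=
      mul_nonpos_of_nonneg_of_nonpos (by positivity) (sub_nonpos.2 h)
    linarith
  -- Otherwise `f` is nonnegative and strictly increasing, which contradicts `f → 0`.
  have hex : ∃ n, mass g (n + 1) ≤ mass g n := by
    by_contra! h
    have hs : StrictMono (mass g) := strictMono_nat_of_lt_succ h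
    have := hs.monotone.ge_of_tendsto (tendsto_mass hg) 1
    linarith [h 0, mass_nonneg hg_nonneg 0, zero_add 1]
  classical
  refine ⟨Nat.find hex, ?_, ?_⟩
  · rw [univ_inter]
    intro i _ j hj hij
    induction j, hij using Nat.le_induction with
    | base => exact le_rfl
    | succ j hij ih =>
      have hlt : j < Nat.find hex := hj
      exact (ih hlt.le).trans (not_le.1 (Nat.find_min hex hlt)).le
  · have hdec : ∀ n, Nat.find hex ≤ n → mass g (n + 1) ≤ mass g n := by
      intro n hn
      induction n, hn using Nat.le_induction with
      | base => exact Nat.find_spec hex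
      | succ n _ ih => exact hstep n ih
    rw [univ_inter]
    intro i hi j _ hij
    induction j, hij using Nat.le_induction with
    | base => exact le_rfl
    | succ j hij ih => exact (hdec j (le_trans hi hij)).trans (ih (le_trans hi hij))

end PoissonMixture

/-! ### Turán inequalities: log-concave and log-convex mixing densities. -/

namespace PoissonMixture

/-- The symmetrised kernel representing `2 * (f n * f (n + 2) - f (n + 1) ^ 2)` for a Poisson
mixture `f`, on the line where the two mixing variables add up to `s`. -/
noncomputable def turanKernel (n : ℕ) (s t : ℝ) : ℝ :=
  weight n t * weight (n + 2) (s - t) + weight (n + 2) t * weight n (s - t) -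
    2 * (weight (n + 1) t * weight (n + 1) (s - t))

lemma turanKernel_eq (n : ℕ) (s t : ℝ) :
    turanKernel n s t = weight n t * weight n (s - t) / ((n + 1) ^ 2 * (n + 2)) *
      ((n + 1) * s ^ 2 - 2 * (2 * n + 3) * (t * (s - t))) := by
  have h1 : (n : ℝ) + 1 ≠ 0 := by positivity
  have h2 : (n : ℝ) + 2 ≠ 0 := by positivity
  have h3 : (n : ℝ) + 1 + 1 ≠ 0 := by positivity
  rw [turanKernel, weight_succ (n + 1), weight_succ n, weight_succ (n + 1), weight_succ n]
  push_cast
  field_simp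
  ring

lemma continuous_turanKernel (n : ℕ) (s : ℝ) : Continuous (turanKernel n s) := by
  have hc : Continuous fun t : ℝ => s - t := by fun_prop
  have h := continuous_weight
  exact (((h _).mul ((h _).comp hc)).add ((h _).mul ((h _).comp hc))).sub
    (continuous_const.mul ((h _).mul ((h _).comp hc)))

lemma hasDerivAt_turanKernel_primitive (n : ℕ) (s t : ℝ) :
    HasDerivAt (fun t => weight (n + 1) t * weight (n + 1) (s - t) * (s - 2 * t) / (n + 2))
      (turanKernel n s t) t := by
  have h1 : (n : ℝ) + 1 ≠ 0 := by positivity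
  have h2 : (n : ℝ) + 2 ≠ 0 := by positivity
  have hs : HasDerivAt (fun t => s - t) (-1) t := by simpa using (hasDerivAt_id t).const_sub s
  have hs2 : HasDerivAt (fun t => s - 2 * t) (-2) t := by
    simpa using ((hasDerivAt_id t).const_mul 2).const_sub s
  have h := ((((hasDerivAt_weight_succ n t).mul
    ((hasDerivAt_weight_succ n (s - t)).comp t hs)).mul hs2).div_const ((n : ℝ) + 2))
  convert! h using 1
  simp only [Pi.mul_apply, Function.comp_apply]
  rw [turanKernel_eq, weight_succ n, weight_succ n]
  field_simp
  ring

lemma integral_turanKernel (n : ℕ) {s : ℝ} (hs : 0 ≤ s) :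
    ∫ t in Ioo 0 s, turanKernel n s t = 0 := by
  rw [← integral_Ioc_eq_integral_Ioo, ← intervalIntegral.integral_of_le hs,
    intervalIntegral.integral_eq_sub_of_hasDerivAt
    (fun t _ => hasDerivAt_turanKernel_primitive n s t)
    ((continuous_turanKernel n s).intervalIntegrable _ _), sub_self, weight_succ_zero]
  simp

/-- The points `a` and `b = s - a` are the zeros of the kernel on `(0, s)`, namely `s * (1 ∓ r) / 2`
with `r ^ 2 = 1 / (2 * n + 3)`. -/
lemma exists_turanKernel_root (n : ℕ) {s : ℝ} (hs : 0 < s) :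
    ∃ a b : ℝ, 0 < a ∧ 0 < b ∧ a + b = s ∧ (n + 1) * s ^ 2 = 2 * (2 * n + 3) * (a * b) := by
  set r := √(1 / (2 * (n : ℝ) + 3)) with hr
  have hr2 : r ^ 2 = 1 / (2 * (n : ℝ) + 3) := Real.sq_sqrt (by positivity)
  have hr0 : 0 ≤ r := Real.sqrt_nonneg _
  have hr1 : r < 1 := by
    refine lt_of_pow_lt_pow_left₀ 2 zero_le_one ?_
    rw [hr2, one_pow, div_lt_one (by positivity)]
    linarith [(n.cast_nonneg : (0 : ℝ) ≤ n)]
  refine ⟨s * (1 - r) / 2, s * (1 + r) / 2, ?_, by positivity, by ring, ?_⟩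
  · have : 0 < 1 - r := sub_pos.2 hr1
    positivity
  · have e : s * (1 - r) / 2 * (s * (1 + r) / 2) = s ^ 2 * (1 - r ^ 2) / 4 := by ring
    rw [e, hr2]
    field_simp
    ring

/-- The mixing density weighted by the Poisson weight `n`, extended by zero. -/
noncomputable def weighted (g : ℝ → ℝ) (n : ℕ) : ℝ → ℝ :=
  indicator (Ioi 0) fun x => weight n x * g x

lemma integral_weighted (g : ℝ → ℝ) (n : ℕ) : ∫ x, weighted g n x = mass g n :=
  integral_indicator measurableSet_Ioi

lemma integrable_weighted {g : ℝ → ℝ} (hg : IntegrableOn g (Ioi 0)) (n : ℕ) :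
    Integrable (weighted g n) :=
  (integrable_indicator_iff measurableSet_Ioi).2 (integrableOn_weight_mul hg n)

lemma weighted_turan_eq (g : ℝ → ℝ) (n : ℕ) (s t : ℝ) :
    weighted g n t * weighted g (n + 2) (s - t) + weighted g (n + 2) t * weighted g n (s - t) -
      2 * (weighted g (n + 1) t * weighted g (n + 1) (s - t)) =
    indicator (Ioo 0 s) (fun t => turanKernel n s t * (g t * g (s - t))) t := by
  by_cases h : t ∈ Ioo 0 s
  · have h1 : t ∈ Ioi (0 : ℝ) := h.1
    have h2 : s - t ∈ Ioi (0 : ℝ) := sub_pos.2 h.2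
    simp only [weighted, indicator_of_mem h1, indicator_of_mem h2, indicator_of_mem h, turanKernel]
    ring
  · rw [indicator_of_notMem h]
    have : t ∉ Ioi (0 : ℝ) ∨ s - t ∉ Ioi (0 : ℝ) := by
      simp only [mem_Ioi, mem_Ioo, not_and_or, sub_pos] at h ⊢
      exact h
    rcases this with h | h <;> simp [weighted, indicator_of_notMem h]

/-- If `c * g a * g b` increases with `a * b` for fixed `a + b`, then the Poisson mixture satisfies
the corresponding Turán type inequality. -/
theorem turan_mass {g : ℝ → ℝ} (hg : IntegrableOn g (Ioi 0)) (c : ℝ)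
    (hprod : ∀ a b t z : ℝ, 0 < a → 0 < b → 0 < t → 0 < z → a + b = t + z → a * b ≤ t * z →
      c * (g a * g b) ≤ c * (g t * g z)) (n : ℕ) :
    c * (mass g n * mass g (n + 2)) ≤ c * mass g (n + 1) ^ 2 := by
  have hI := integrable_weighted hg
  -- The integral of a convolution is the product of the integrals; the convolution variable `s` is
  -- the slicing parameter.
  have hmul : ∀ i j : ℕ, ∫ s, ∫ t, weighted g i t * weighted g j (s - t) =
      mass g i * mass g j := fun i j => by
    have h := integral_convolution (μ := volume) (ν := volume) (ContinuousLinearMap.mul ℝ ℝ)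
      (hI i) (hI j)
    rw [integral_weighted, integral_weighted] at h
    exact h
  have hint : ∀ i j : ℕ, Integrable fun s => ∫ t, weighted g i t * weighted g j (s - t) :=
    fun i j => Integrable.integrable_convolution (ContinuousLinearMap.mul ℝ ℝ) (hI i) (hI j)
  have hex : ∀ i j : ℕ, ∀ᵐ s, Integrable fun t => weighted g i t * weighted g j (s - t) :=
    fun i j => Integrable.ae_convolution_exists (μ := volume) (ν := volume)
      (ContinuousLinearMap.mul ℝ ℝ) (hI i) (hI j)
  have hinner : ∀ᵐ s : ℝ, c * ((∫ t, weighted g n t * weighted g (n + 2) (s - t)) +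
      (∫ t, weighted g (n + 2) t * weighted g n (s - t)) -
      2 * ∫ t, weighted g (n + 1) t * weighted g (n + 1) (s - t)) ≤ 0 := by
    filter_upwards [hex n (n + 2), hex (n + 2) n, hex (n + 1) (n + 1)] with s h1 h2 h3
    have h12 : Integrable fun t => weighted g n t * weighted g (n + 2) (s - t) +
      weighted g (n + 2) t * weighted g n (s - t) := h1.add h2
    have h123 : Integrable fun t => weighted g n t * weighted g (n + 2) (s - t) +
      weighted g (n + 2) t * weighted g n (s - t) -
      2 * (weighted g (n + 1) t * weighted g (n + 1) (s - t)) := h12.sub (h3.const_mul 2)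
    rw [← integral_const_mul, ← integral_add h1 h2, ← integral_sub h12 (h3.const_mul 2)]
    simp only [weighted_turan_eq] at h123 ⊢
    rw [integral_indicator measurableSet_Ioo]
    rw [integrable_indicator_iff measurableSet_Ioo] at h123
    rcases le_or_gt s 0 with hs | hs
    · simp [Ioo_eq_empty (not_lt.2 hs)]
    obtain ⟨a, b, ha, hb, hab, hroot⟩ := exists_turanKernel_root n hs
    rw [← integral_const_mul]
    calc ∫ t in Ioo 0 s, c * (turanKernel n s t * (g t * g (s - t)))
        ≤ ∫ t in Ioo 0 s, turanKernel n s t * (c * (g a * g b)) := by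
          refine setIntegral_mono_on (h123.const_mul c)
            (((continuous_turanKernel n s).integrableOn_Icc.mono_set Ioo_subset_Icc_self).mul_const _)
            measurableSet_Ioo fun t ht => ?_
          have hz : 0 < s - t := sub_pos.2 ht.2
          have hw : 0 < weight n t * weight n (s - t) / ((n + 1) ^ 2 * (n + 2)) := by
            have := weight_pos n ht.1
            have := weight_pos n hz
            positivity
          have hn : (0 : ℝ) < 2 * (2 * n + 3) := by positivity
          -- The kernel has the sign of `a * b - t * (s - t)`, opposite to that of the change in `c
          -- * (g t * g (s - t))`.
          have key : (a * b - t * (s - t)) * (c * (g t * g (s - t)) - c * (g a * g b)) ≤ 0 := by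
            rcases le_total (a * b) (t * (s - t)) with h | h
            · exact mul_nonpos_of_nonpos_of_nonneg (sub_nonpos.2 h)
                (sub_nonneg.2 (hprod a b t (s - t) ha hb ht.1 hz (by linarith) h))
            · exact mul_nonpos_of_nonneg_of_nonpos (sub_nonneg.2 h)
                (sub_nonpos.2 (hprod t (s - t) a b ht.1 hz ha hb (by linarith) h))
          have := mul_nonpos_of_nonneg_of_nonpos (mul_pos hw hn).le key
          rw [turanKernel_eq, hroot]
          linarith
      _ = 0 := by rw [integral_mul_const, integral_turanKernel n hs.le, zero_mul]
  have hle := integral_nonpos_of_ae hinner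
  have hadd : Integrable fun s => (∫ t, weighted g n t * weighted g (n + 2) (s - t)) +
      ∫ t, weighted g (n + 2) t * weighted g n (s - t) := (hint n (n + 2)).add (hint (n + 2) n)
  rw [integral_const_mul, integral_sub hadd ((hint _ _).const_mul 2),
    integral_add (hint _ _) (hint _ _), integral_const_mul, hmul, hmul, hmul] at hle
  linarith

/-- Since `(t - a) * (t - b) = a * b - t * z ≤ 0`, the point `t` lies between `a` and `b`, and `z`
is its mirror image. -/
lemma exists_convex_weights {a b t z : ℝ} (hsum : a + b = t + z) (hprod : a * b ≤ t * z) :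
    ∃ θ ∈ Icc (0 : ℝ) 1, t = θ * a + (1 - θ) * b ∧ z = (1 - θ) * a + θ * b := by
  obtain rfl : z = a + b - t := by linarith
  have h : (t - a) * (t - b) ≤ 0 := by linarith
  have hmem : t ∈ uIcc a b := by
    rw [mem_uIcc]
    rcases mul_nonpos_iff.1 h with ⟨h1, h2⟩ | ⟨h1, h2⟩
    · exact .inl ⟨by linarith, by linarith⟩
    · exact .inr ⟨by linarith, by linarith⟩
  rw [← segment_eq_uIcc] at hmem
  obtain ⟨u, v, hu, hv, huv, rfl⟩ := hmem
  obtain rfl : v = 1 - u := by linarith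
  refine ⟨u, ⟨hu, by linarith⟩, rfl, ?_⟩
  simp only [smul_eq_mul]
  ring

lemma LogConcaveOn.mul_le_mul {g : ℝ → ℝ} (h : LogConcaveOn (Ioi 0) g) {a b t z : ℝ}
    (ha : 0 < a) (hb : 0 < b) (hsum : a + b = t + z) (hprod : a * b ≤ t * z) :
    g a * g b ≤ g t * g z := by
  obtain ⟨θ, ⟨h0, h1⟩, rfl, rfl⟩ := exists_convex_weights hsum hprod
  rcases h0.eq_or_lt with rfl | h0
  · simp [mul_comm]
  rcases h1.eq_or_lt with rfl | h1
  · simp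
  have hga := h.1 a ha
  have hgb := h.1 b hb
  have e1 := h.2 a ha b hb θ ⟨h0, h1⟩
  have e2 := h.2 a ha b hb (1 - θ) ⟨by linarith, by linarith⟩
  rw [sub_sub_cancel] at e2
  -- The exponents add up to `1 ≠ 0`, so the splitting also holds at `x = 0`, where `g` may vanish.
  have hpow : ∀ x : ℝ, 0 ≤ x → x = x ^ θ * x ^ (1 - θ) := fun x hx => by
    rw [← Real.rpow_add' hx (by simp), add_sub_cancel, Real.rpow_one]
  calc g a * g b = (g a ^ θ * g b ^ (1 - θ)) * (g a ^ (1 - θ) * g b ^ θ) := by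
        conv_lhs => rw [hpow _ hga, hpow _ hgb]
        ring
    _ ≤ _ := _root_.mul_le_mul e1 e2 (by positivity) ((by positivity : (0 : ℝ) ≤ _).trans e1)

lemma LogConvexOn.mul_le_mul {g : ℝ → ℝ} (h : LogConvexOn (Ioi 0) g) {a b t z : ℝ}
    (ha : 0 < a) (hb : 0 < b) (ht : 0 < t) (hz : 0 < z)
    (hsum : a + b = t + z) (hprod : a * b ≤ t * z) : g t * g z ≤ g a * g b := by
  obtain ⟨θ, ⟨h0, h1⟩, rfl, rfl⟩ := exists_convex_weights hsum hprod
  have hga := h.1 a ha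
  have hgb := h.1 b hb
  have hgt := h.1 _ ht
  have hgz := h.1 _ hz
  have e1 := h.2.2 ha hb h0 (sub_nonneg.2 h1) (by ring)
  have e2 := h.2.2 ha hb (sub_nonneg.2 h1) h0 (by ring)
  simp only [smul_eq_mul] at e1 e2
  rw [← Real.log_le_log_iff (by positivity) (by positivity), Real.log_mul hgt.ne' hgz.ne',
    Real.log_mul hga.ne' hgb.ne']
  linarith

end PoissonMixture

theorem theorem3 {Ω : Type*} [MeasurableSpace Ω] (P : Measure Ω) [IsProbabilityMeasure P]
    (X : Ω → ℝ) (Y : Ω → ℕ) (g : ℝ → ℝ)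
    (hg_meas : AEMeasurable g (volume.restrict (Ioi (0 : ℝ))))
    (hg_nonneg : ∀ x ∈ Ioi (0 : ℝ), 0 ≤ g x)
    (hX : HasLaw X
      ((volume.restrict (Ioi (0 : ℝ))).withDensity (fun x => ENNReal.ofReal (g x))) P)
    (hY : HasCondDistrib Y X PoissonMixture.poissonLawKernel P) :
    (PoissonMixture.UnimodalOn (Ioi (0 : ℝ)) g →
      PoissonMixture.UnimodalOn univ (fun y : ℕ => (P.map Y).real {y})) ∧
    (AntitoneOn g (Ioi (0 : ℝ)) → Antitone (fun y : ℕ => (P.map Y).real {y})) ∧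
    (PoissonMixture.LogConcaveOn (Ioi (0 : ℝ)) g →
      PoissonMixture.LogConcaveSeq (fun y : ℕ => (P.map Y).real {y})) ∧
    (PoissonMixture.LogConvexOn (Ioi (0 : ℝ)) g →
      PoissonMixture.LogConvexSeq (fun y : ℕ => (P.map Y).real {y})) := by
  have hint := PoissonMixture.integrableOn_density hg_meas hg_nonneg hX
  have hpos := PoissonMixture.mass_pos hg_nonneg hint
    (PoissonMixture.integral_density_eq_one hg_meas hg_nonneg hX)
  have hf : (fun y : ℕ => (P.map Y).real {y}) = PoissonMixture.mass g :=
    funext (PoissonMixture.map_real_singleton_eq_mass hg_meas hg_nonneg hX hY)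
  rw [hf]
  refine ⟨PoissonMixture.unimodalOn_mass hg_nonneg hint, PoissonMixture.antitone_mass hint,
    fun h => ⟨fun n => (hpos n).le, fun _ j _ _ _ _ _ => hpos j, fun n => ?_⟩,
    fun h => ⟨hpos, fun n => ?_⟩⟩
  -- The sign `c` is `1` for log-concavity and `-1`, reversing both inequalities, for log-convexity.
  · have := PoissonMixture.turan_mass hint 1 (fun a b t z ha hb _ _ hs hp => by
      simpa using h.mul_le_mul ha hb hs hp) n
    linarith
  · have := PoissonMixture.turan_mass hint (-1) (fun a b t z ha hb ht hz hs hp => by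
      simpa using h.mul_le_mul ha hb ht hz hs hp) n
    linarith
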